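/- Let $D=\{x\in\mathbb R^2: |x|<1\}$ be the unit disk and, for $R\in(0,1)$, let $D(R)=\{x\in\mathbb R^2: R<|x|<1\}$. For $n\in\{0,1,2,\dots\}$ let $J_n(z)=\sum_{m\ge 0}\frac{(-1)^m}{m!\,(m+n)!}\left(\frac z2\right)^{2m+n}$ be the Bessel function of the first kind, and let $\alpha_{n1}<\alpha_{n2}<\dots$ be the positive zeros, in increasing order, of one of the following functions: $J_n(z)$ (Dirichlet condition $u=0$), $J_n'(z)$ (Neumann condition $\partial u/\partial n=0$), or, for a constant $h\ge 0$, $zJ_n'(z)+hJ_n(z)$ (Robin condition $\partial u/\partial n+hu=0$) or $J_n'(z)+hJ_n(z)$ (Robin condition $\partial u/\partial n+\alpha_{nk} h\,u=0$, whose parameter is scaled by the frequency). For $k=1,2,3,\dots$ let $u_{nk}$ be a corresponding Laplacian eigenfunction of the unit disk, that is, any linear combination, not identically zero on $D$, of the functions given in polar coordinates by $$J_n(\alpha_{nk}r)\cos(n\varphi)\quad\text{and}\quad J_n(\alpha_{nk}r)\sin(n\varphi)$$ (the coefficients are real and may depend on $k$). Let $1\le p\le\infty$. Then $0<\|u_{nk}\|_{L_p(D)}<\infty$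 for every $k\ge 1$, and for every fixed $n\in\{0,1,2,\dots\}$ and $R\in(0,1)$, $$\lim_{k\to\infty}\frac{\|u_{nk}\|_{L_p(D(R))}}{\|u_{nk}\|_{L_p(D)}}=\begin{cases}(1-R^{2-p/2})^{1/p} & (1\le p<4),\\ 0 & (4<p\le\infty).\end{cases}$$ -/

import Mathlib

open Filter Topology MeasureTheory
open scoped NNReal ENNReal Nat

noncomputable section

/-- The Bessel function of the first kind `J_n` of integer order `n ≥ 0`, on the real line. -/
def besselJ (n : ℕ) (x : ℝ) : ℝ :=
  ∑' m : ℕ, (-1 : ℝ) ^ m / ((m ! : ℝ) * ((m + n)! : ℝ)) * (x / 2) ^ (2 * m + n)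

/-- The series defining `J_n` converges for every real argument. -/
theorem summable_besselJ (n : ℕ) (x : ℝ) :
    Summable fun m : ℕ =>
      (-1 : ℝ) ^ m / ((m ! : ℝ) * ((m + n)! : ℝ)) * (x / 2) ^ (2 * m + n) := by
  have h : Summable fun m : ℕ => |x / 2| ^ n * (((x / 2) ^ 2) ^ m / (m ! : ℝ)) :=
    (Real.summable_pow_div_factorial _).mul_left _
  refine Summable.of_norm_bounded h fun m => ?_
  have h1 : (1 : ℝ) ≤ ((m + n)! : ℝ) := by exact_mod_cast Nat.factorial_pos _
  have h2 : (0 : ℝ) < (m ! : ℝ) := by exact_mod_cast Nat.factorial_pos _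
  have h3 : |x / 2| ^ (2 * m + n) = |x / 2| ^ n * ((x / 2) ^ 2) ^ m := by
    rw [pow_add, pow_mul, sq_abs, mul_comm]
  rw [Real.norm_eq_abs, abs_mul, abs_div, abs_pow, abs_pow, h3, abs_neg, abs_one, one_pow,
    abs_of_pos (by positivity : (0 : ℝ) < (m ! : ℝ) * ((m + n)! : ℝ)), mul_comm, mul_div_assoc',
    mul_one, mul_div_assoc]
  gcongr
  exact le_mul_of_one_le_right h2.le h1

/-- The boundary conditions on the unit circle. For `u(r, φ) = J_n(α r) (a cos nφ + b sin nφ)`: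
* `dirichlet`: `u = 0`;
* `neumann`: `∂u/∂n = 0`;
* `robin h`: `∂u/∂n + h u = 0`;
* `robinScaled h`: `∂u/∂n + α h u = 0`, i.e. the Robin parameter scales with the frequency `α`;
  this is the case in which `α` is a zero of `J_n' + h J_n`. -/
inductive BoundaryCondition where
  | dirichlet
  | neumann
  | robin (h : ℝ≥0)
  | robinScaled (h : ℝ≥0)

/-- The function whose positive zeros are the numbers `α_{nk}`. -/
def BoundaryCondition.charFun (n : ℕ) : BoundaryCondition → ℝ → ℝ
  | dirichlet, z => besselJ n z
  | neumann, z => deriv (besselJ n) z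
  | robin h, z => z * deriv (besselJ n) z + h * besselJ n z
  | robinScaled h, z => deriv (besselJ n) z + h * besselJ n z

/-- `alpha bc n k` is, for `k = 1, 2, 3, …`, the `k`-th positive zero of `bc.charFun n` in
increasing order (with the convention `alpha bc n 0 = 0`): each one is the smallest zero larger
than its predecessor. -/
def alpha (bc : BoundaryCondition) (n : ℕ) : ℕ → ℝ
  | 0 => 0
  | k + 1 => sInf {z : ℝ | alpha bc n k < z ∧ bc.charFun n z = 0}

/-- The polar angle of a point of the plane. -/
def polarAngle (x : EuclideanSpace ℝ (Fin 2)) : ℝ := Complex.arg ⟨x 0, x 1⟩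

/-- `u_{nk1}(r, φ) = J_n(α_{nk} r) cos nφ`. -/
def modeCos (bc : BoundaryCondition) (n k : ℕ) (x : EuclideanSpace ℝ (Fin 2)) : ℝ :=
  besselJ n (alpha bc n k * ‖x‖) * Real.cos (n * polarAngle x)

/-- `u_{nk2}(r, φ) = J_n(α_{nk} r) sin nφ`. -/
def modeSin (bc : BoundaryCondition) (n k : ℕ) (x : EuclideanSpace ℝ (Fin 2)) : ℝ :=
  besselJ n (alpha bc n k * ‖x‖) * Real.sin (n * polarAngle x)

/-- The open unit disk. -/
def unitDisk : Set (EuclideanSpace ℝ (Fin 2)) := {x | ‖x‖ < 1}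

/-- The annulus `R < |x| < 1`. -/
def annulus (R : ℝ) : Set (EuclideanSpace ℝ (Fin 2)) := {x | R < ‖x‖ ∧ ‖x‖ < 1}

/-- `u` is an eigenfunction `u_{nk}` of the unit disk: on the disk it is a linear combination of
`u_{nk1}` and `u_{nk2}` that does not vanish identically. -/
def IsDiskMode (bc : BoundaryCondition) (n k : ℕ) (u : EuclideanSpace ℝ (Fin 2) → ℝ) : Prop :=
  (∃ a b : ℝ, ∀ x ∈ unitDisk, u x = a * modeCos bc n k x + b * modeSin bc n k x) ∧
    ∃ x ∈ unitDisk, u x ≠ 0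

/-- The ratio `‖u‖_{L_p(R < |x| < 1)} / ‖u‖_{L_p(D)}`. -/
def lpRatio (p : ℝ≥0∞) (R : ℝ) (u : EuclideanSpace ℝ (Fin 2) → ℝ) : ℝ :=
  (eLpNorm u p (volume.restrict (annulus R))).toReal /
    (eLpNorm u p (volume.restrict unitDisk)).toReal

end

/-! A mode is a radial factor times an angular factor, so for finite p the angular integral cancels
from the ratio. With q = p and F(x) = ∫₀ˣ |J_n(s)|^q s ds, what remains is ((F(α) - F(Rα)) /
F(α))^(1/q). Since α_{nk} → ∞ (`tendsto_alpha`), only the growth of F at infinity matters.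

The function w = √x J_n satisfies w'' = (c/x² - 1) w, hence approaches a nonzero sinusoid
(`exists_asymptotic_of_ode`), and the integrand of F is x^(1-q/2) |w|^q. For q < 4 the power is
integrated against a positive mean, so F(x) ~ C x^(2-q/2) (`exists_tendsto_radialMass_div`), and the
limit follows. For 4 < q < ∞ the mass on [Rx, x] is O(x^(2-q/2)) and tends to 0, while F(x) ≥ F(1) >
0 for x ≥ 1. For p = ∞ the mode is O(α^(-1/2)) on the annulus relative to its size at radius s/α, s
fixed (`lpRatio_top_diskMode_le`).

The boundary condition enters only through α_{nk} → ∞: the sinusoidal asymptotics supply arbitrarily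
large zeros, and analyticity prevents them from accumulating. -/

/-! ### Power series, recurrences and analyticity of the Bessel functions -/

/-- The entire function `φ_n` with `J_n(x) = (x / 2) ^ n * φ_n((x / 2) ^ 2)`. -/
noncomputable def besselEntire (n : ℕ) (t : ℝ) : ℝ :=
  ∑' m : ℕ, (-1 : ℝ) ^ m / ((m ! : ℝ) * ((m + n)! : ℝ)) * t ^ m

theorem norm_besselCoeff_le (n m : ℕ) :
    ‖(-1 : ℝ) ^ m / ((m ! : ℝ) * ((m + n)! : ℝ))‖ ≤ 1 / (m ! : ℝ) := by
  have h1 : (1 : ℝ) ≤ ((m + n)! : ℝ) := by exact_mod_cast Nat.factorial_pos _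
  have h2 : (0 : ℝ) < (m ! : ℝ) := by exact_mod_cast Nat.factorial_pos _
  rw [norm_div, norm_pow, norm_neg, norm_one, one_pow, Real.norm_of_nonneg (by positivity)]
  gcongr
  exact le_mul_of_one_le_right h2.le h1

theorem summable_besselEntire (n : ℕ) (t : ℝ) :
    Summable fun m : ℕ => (-1 : ℝ) ^ m / ((m ! : ℝ) * ((m + n)! : ℝ)) * t ^ m := by
  refine Summable.of_norm_bounded (Real.summable_pow_div_factorial |t|) fun m => ?_
  rw [norm_mul, norm_pow, Real.norm_eq_abs t, div_eq_inv_mul (|t| ^ m), ← one_div]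
  exact mul_le_mul_of_nonneg_right (norm_besselCoeff_le n m) (by positivity)

theorem besselJ_eq (n : ℕ) (x : ℝ) :
    besselJ n x = (x / 2) ^ n * besselEntire n ((x / 2) ^ 2) := by
  rw [besselJ, besselEntire, ← tsum_mul_left]
  refine tsum_congr fun m => ?_
  rw [pow_add, pow_mul]
  ring

theorem hasDerivAt_besselEntire (n : ℕ) (t : ℝ) :
    HasDerivAt (besselEntire n) (-besselEntire (n + 1) t) t := by
  have hr : 0 < |t| + 1 := by positivity
  have hu : Summable fun m : ℕ => 1 / (m ! : ℝ) * (m * (|t| + 1) ^ (m - 1)) := by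
    rw [← summable_nat_add_iff 1]
    refine (Real.summable_pow_div_factorial (|t| + 1)).congr fun m => ?_
    rw [Nat.factorial_succ]
    have : (m ! : ℝ) ≠ 0 := by positivity
    push_cast
    field_simp
  have key := hasDerivAt_tsum_of_isPreconnected (𝕜 := ℝ) (t := Metric.ball 0 (|t| + 1)) (y₀ := 0)
    (y := t) hu
    Metric.isOpen_ball (convex_ball _ _).isPreconnected
    (g := fun m t => (-1 : ℝ) ^ m / ((m ! : ℝ) * ((m + n)! : ℝ)) * t ^ m)
    (g' := fun m t => (-1 : ℝ) ^ m / ((m ! : ℝ) * ((m + n)! : ℝ)) * (m * t ^ (m - 1)))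
    (fun m y _ => (hasDerivAt_pow m y).const_mul _) ?_ (by simpa using hr)
    (summable_besselEntire n 0) (by simp)
  · have h : ∑' m : ℕ, (-1 : ℝ) ^ m / ((m ! : ℝ) * ((m + n)! : ℝ)) * (m * t ^ (m - 1))
        = -besselEntire (n + 1) t := by
      -- The term m = 0 vanishes; shifting the index turns (m + n)! into (m + (n + 1))!.
      rw [tsum_eq_zero_add', besselEntire, ← tsum_neg]
      · simp only [CharP.cast_eq_zero, zero_mul, mul_zero, zero_add]
        refine tsum_congr fun m => ?_
        rw [Nat.factorial_succ, show m + 1 + n = m + (n + 1) by ring]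
        have : (m ! : ℝ) ≠ 0 := by positivity
        have : ((m + (n + 1))! : ℝ) ≠ 0 := by positivity
        push_cast
        field_simp
        ring
      · refine (summable_besselEntire (n + 1) t).neg.congr fun m => ?_
        rw [Nat.factorial_succ, show m + 1 + n = m + (n + 1) by ring]
        have : (m ! : ℝ) ≠ 0 := by positivity
        have : ((m + (n + 1))! : ℝ) ≠ 0 := by positivity
        push_cast
        field_simp
        ring
    rw [h] at key
    exact key
  · intro m y hy
    have hy' : |y| ≤ |t| + 1 := by
      rw [Metric.mem_ball, dist_zero_right] at hy
      exact hy.le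
    rw [norm_mul, norm_mul, norm_pow, Real.norm_eq_abs y, Real.norm_natCast]
    gcongr
    exact norm_besselCoeff_le n m

/-- Up to sign, coefficients compare by 1/(m!(m+n)!) - (n+1)/(m!(m+n+1)!) = m/(m!(m+n+1)!), which
vanishes at m = 0 and cancels to 1/((m-1)!(m+n+1)!) otherwise. -/
theorem besselEntire_recurrence (n : ℕ) (t : ℝ) :
    besselEntire n t = (n + 1) * besselEntire (n + 1) t - t * besselEntire (n + 2) t := by
  have h1 := (summable_besselEntire n t).sub ((summable_besselEntire (n + 1) t).mul_left (n + 1 : ℝ))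
  have h2 : besselEntire n t - (n + 1) * besselEntire (n + 1) t = -(t * besselEntire (n + 2) t) := by
    rw [besselEntire, besselEntire, besselEntire, ← tsum_mul_left,
      ← (summable_besselEntire n t).tsum_sub ((summable_besselEntire (n + 1) t).mul_left _),
      h1.tsum_eq_zero_add, ← tsum_mul_left, ← tsum_neg]
    have h0 : (n ! : ℝ) ≠ 0 := by positivity
    have h3 : ∀ m : ℕ, (-1 : ℝ) ^ (m + 1) / (((m + 1)! : ℝ) * ((m + 1 + n)! : ℝ)) * t ^ (m + 1) -
        (n + 1) * ((-1 : ℝ) ^ (m + 1) / (((m + 1)! : ℝ) * ((m + 1 + (n + 1))! : ℝ)) * t ^ (m + 1)) =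
        -(t * ((-1 : ℝ) ^ m / ((m ! : ℝ) * ((m + (n + 2))! : ℝ)) * t ^ m)) := fun m => by
      rw [show m + 1 + (n + 1) = (m + n + 1) + 1 by ring, show m + (n + 2) = (m + n + 1) + 1 by ring,
        show m + 1 + n = m + n + 1 by ring, Nat.factorial_succ (m + n + 1), Nat.factorial_succ m]
      have : (m ! : ℝ) ≠ 0 := by positivity
      have : ((m + n + 1)! : ℝ) ≠ 0 := by positivity
      push_cast
      field_simp
      ring
    rw [tsum_congr h3]
    simp only [pow_zero, Nat.factorial_zero, zero_add, Nat.factorial_succ]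
    push_cast
    field_simp
    ring
  linarith

/-- Analyticity serves to isolate the zeros of the characteristic functions. -/
theorem analyticAt_besselEntire (n : ℕ) (t : ℝ) : AnalyticAt ℝ (besselEntire n) t := by
  set c : ℕ → ℝ := fun m => (-1 : ℝ) ^ m / ((m ! : ℝ) * ((m + n)! : ℝ)) with hc
  have hrad : (FormalMultilinearSeries.ofScalars ℝ c).radius = ⊤ := by
    apply FormalMultilinearSeries.radius_eq_top_of_summable_norm
    intro r
    refine Summable.of_norm_bounded (Real.summable_pow_div_factorial r) fun m => ?_
    rw [FormalMultilinearSeries.ofScalars_norm, norm_mul, norm_norm, norm_pow,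
      Real.norm_of_nonneg (NNReal.coe_nonneg r), div_eq_inv_mul, ← one_div]
    exact mul_le_mul_of_nonneg_right (norm_besselCoeff_le n m) (by positivity)
  have h := (FormalMultilinearSeries.ofScalars ℝ c).hasFPowerSeriesOnBall (by rw [hrad]; simp)
  have h2 : (FormalMultilinearSeries.ofScalars ℝ c).sum = besselEntire n := by
    funext x
    rw [besselEntire, FormalMultilinearSeries.sum]
    refine tsum_congr fun m => ?_
    rw [FormalMultilinearSeries.ofScalars_apply_eq, smul_eq_mul]
  rw [h2] at h
  exact h.analyticAt_of_mem (by rw [hrad]; simp)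

theorem analyticAt_besselJ (n : ℕ) (x : ℝ) : AnalyticAt ℝ (besselJ n) x := by
  have h : besselJ n = fun x => (x / 2) ^ n * besselEntire n ((x / 2) ^ 2) :=
    funext (besselJ_eq n)
  rw [h]
  have hid : AnalyticAt ℝ (fun x : ℝ => x / 2) x := by fun_prop
  exact (hid.pow n).mul ((analyticAt_besselEntire n _).comp (hid.pow 2))

theorem continuous_besselJ (n : ℕ) : Continuous (besselJ n) :=
  continuous_iff_continuousAt.2 fun x => (analyticAt_besselJ n x).continuousAt

theorem analyticAt_deriv_besselJ (n : ℕ) (x : ℝ) : AnalyticAt ℝ (deriv (besselJ n)) x :=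
  (analyticAt_besselJ n x).deriv

theorem hasDerivAt_besselJ (n : ℕ) {x : ℝ} (hx : x ≠ 0) :
    HasDerivAt (besselJ n) (n / x * besselJ n x - besselJ (n + 1) x) x := by
  have h : besselJ n = fun x => (x / 2) ^ n * besselEntire n ((x / 2) ^ 2) :=
    funext (besselJ_eq n)
  have hid : HasDerivAt (fun x : ℝ => x / 2) (1 / 2) x := (hasDerivAt_id x).div_const 2
  have key := (hid.pow n).mul ((hasDerivAt_besselEntire n ((x / 2) ^ 2)).comp x (hid.pow 2))
  rw [h]
  refine key.congr_deriv ?_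
  simp only [besselJ_eq (n + 1), Pi.pow_apply, Function.comp_apply]
  rcases n with _ | n
  · simp
    ring
  · simp only [add_tsub_cancel_right]
    field_simp
    ring

theorem besselJ_recurrence (n : ℕ) {x : ℝ} (hx : x ≠ 0) :
    besselJ n x + besselJ (n + 2) x = 2 * (n + 1) / x * besselJ (n + 1) x := by
  simp only [besselJ_eq]
  rw [besselEntire_recurrence n]
  field_simp
  ring

theorem hasDerivAt_besselJ_succ (n : ℕ) {x : ℝ} (hx : x ≠ 0) :
    HasDerivAt (besselJ (n + 1)) (besselJ n x - (n + 1) / x * besselJ (n + 1) x) x := by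
  refine (hasDerivAt_besselJ (n + 1) hx).congr_deriv ?_
  have := besselJ_recurrence n hx
  have h2 : besselJ (n + 1 + 1) x = 2 * (n + 1) / x * besselJ (n + 1) x - besselJ n x := by
    linarith
  rw [h2]
  push_cast
  ring

/-- Near the origin, but not at it, `J_n` does not vanish. -/
theorem eventually_besselJ_ne_zero (n : ℕ) : ∀ᶠ x in 𝓝[>] (0 : ℝ), besselJ n x ≠ 0 := by
  have h0 : besselEntire n 0 ≠ 0 := by
    rw [besselEntire, tsum_eq_single 0 (fun m hm => by simp [hm])]
    have : (n ! : ℝ) ≠ 0 := by positivity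
    simpa using this
  have hc : ContinuousAt (fun x : ℝ => besselEntire n ((x / 2) ^ 2)) 0 := by
    have h1 : ContinuousAt (besselEntire n) ((0 / 2 : ℝ) ^ 2) := (analyticAt_besselEntire n _).continuousAt
    exact ContinuousAt.comp (f := fun x : ℝ => (x / 2) ^ 2) h1 (by fun_prop)
  have h2 : ∀ᶠ x in 𝓝 (0 : ℝ), besselEntire n ((x / 2) ^ 2) ≠ 0 := hc.eventually_ne (by simpa using h0)
  filter_upwards [h2.filter_mono nhdsWithin_le_nhds, self_mem_nhdsWithin] with x hx hx0
  rw [besselJ_eq]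
  have : (0 : ℝ) < x := hx0
  exact mul_ne_zero (by positivity) hx

/-! ### The normal form of the Bessel equation -/

/-- The function `√x * J_n(x)`. -/
noncomputable def scaledBessel (n : ℕ) (x : ℝ) : ℝ := √x * besselJ n x

/-- The derivative of `√x * J_n(x)` on the positive half-line. -/
noncomputable def scaledBesselDeriv (n : ℕ) (x : ℝ) : ℝ :=
  (n + 1 / 2) / x * scaledBessel n x - scaledBessel (n + 1) x

theorem hasDerivAt_scaledBessel (n : ℕ) {x : ℝ} (hx : 0 < x) :
    HasDerivAt (scaledBessel n) (scaledBesselDeriv n x) x := by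
  refine ((Real.hasDerivAt_sqrt hx.ne').mul (hasDerivAt_besselJ n hx.ne')).congr_deriv ?_
  rw [scaledBesselDeriv, scaledBessel, scaledBessel]
  have h := Real.sqrt_pos.2 hx
  have h2 := Real.sq_sqrt hx.le
  have h3 : 1 / (2 * √x) = √x / (2 * x) := by
    field_simp
    linarith
  rw [h3]
  field_simp
  ring

theorem hasDerivAt_scaledBessel_succ (n : ℕ) {x : ℝ} (hx : 0 < x) :
    HasDerivAt (scaledBessel (n + 1))
      (scaledBessel n x - (n + 1 / 2) / x * scaledBessel (n + 1) x) x := by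
  refine ((Real.hasDerivAt_sqrt hx.ne').mul (hasDerivAt_besselJ_succ n hx.ne')).congr_deriv ?_
  rw [scaledBessel, scaledBessel]
  have h := Real.sqrt_pos.2 hx
  have h2 := Real.sq_sqrt hx.le
  have h3 : 1 / (2 * √x) = √x / (2 * x) := by
    field_simp
    linarith
  rw [h3]
  field_simp
  ring

/-- The normal form of the Bessel equation. -/
theorem hasDerivAt_scaledBesselDeriv (n : ℕ) {x : ℝ} (hx : 0 < x) :
    HasDerivAt (scaledBesselDeriv n) ((((n : ℝ) ^ 2 - 1 / 4) / x ^ 2 - 1) * scaledBessel n x) x := by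
  have h1 : HasDerivAt (fun x : ℝ => (n + 1 / 2 : ℝ) / x) (-(n + 1 / 2) / x ^ 2) x := by
    simp only [div_eq_mul_inv _ (_ : ℝ)]
    refine ((hasDerivAt_inv hx.ne').const_mul (n + 1 * 2⁻¹ : ℝ)).congr_deriv ?_
    ring
  refine ((h1.mul (hasDerivAt_scaledBessel n hx)).sub
    (hasDerivAt_scaledBessel_succ n hx)).congr_deriv ?_
  rw [scaledBesselDeriv]
  field_simp
  ring

/-! ### Asymptotics of solutions of w'' = (c/x² - 1) w -/

section Asymptotics

variable {w w' : ℝ → ℝ} {c : ℝ}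

/-- The energy of a solution of the equation `d²w/dx² = (c / x² - 1) w` stays bounded and bounded away
from zero. -/
theorem energy_bounds_of_ode {z : ℝ} (hz : 0 < z)
    (hw : ∀ x, 0 < x → HasDerivAt w (w' x) x)
    (hw' : ∀ x, 0 < x → HasDerivAt w' ((c / x ^ 2 - 1) * w x) x) {x : ℝ} (hx : z ≤ x) :
    (w z ^ 2 + w' z ^ 2) * Real.exp (-|c| / z) ≤ w x ^ 2 + w' x ^ 2 ∧
      w x ^ 2 + w' x ^ 2 ≤ (w z ^ 2 + w' z ^ 2) * Real.exp (|c| / z) := by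
  -- The energy E has |E'| ≤ (|c|/x²) E, so E exp(-|c|/x) increases and E exp(|c|/x) decreases.
  have hE : ∀ y, 0 < y → HasDerivAt (fun x => w x ^ 2 + w' x ^ 2) (2 * c / y ^ 2 * (w y * w' y)) y :=
    fun y hy => by
      refine (((hw y hy).pow 2).add ((hw' y hy).pow 2)).congr_deriv ?_
      push_cast
      ring
  have hexp : ∀ (d : ℝ) (y : ℝ), 0 < y →
      HasDerivAt (fun x : ℝ => Real.exp (d / x)) (Real.exp (d / y) * (-d / y ^ 2)) y :=
    fun d y hy => by
      have : HasDerivAt (fun x : ℝ => d / x) (-d / y ^ 2) y := by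
        simp only [div_eq_mul_inv]
        refine ((hasDerivAt_inv hy.ne').const_mul d).congr_deriv ?_
        ring
      exact this.exp
  have hbound : ∀ y, |2 * c / y ^ 2 * (w y * w' y)| ≤ |c| / y ^ 2 * (w y ^ 2 + w' y ^ 2) := by
    intro y
    have h1 : |2 * c / y ^ 2 * (w y * w' y)| = |c| / y ^ 2 * (2 * |w y| * |w' y|) := by
      rw [abs_mul, abs_div, abs_mul, abs_mul, abs_two, abs_of_nonneg (sq_nonneg y)]
      ring
    rw [h1, ← sq_abs (w y), ← sq_abs (w' y)]
    exact mul_le_mul_of_nonneg_left (two_mul_le_add_sq _ _) (by positivity)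
  have hexp_le : ∀ d : ℝ, d ≤ 0 → Real.exp (d / x) ≤ 1 := fun d hd =>
    Real.exp_le_one_iff.2 (div_nonpos_of_nonpos_of_nonneg hd (hz.trans_le hx).le)
  have hexp_ge : ∀ d : ℝ, 0 ≤ d → 1 ≤ Real.exp (d / x) := fun d hd =>
    Real.one_le_exp (div_nonneg hd (hz.trans_le hx).le)
  have hEnn : 0 ≤ w x ^ 2 + w' x ^ 2 := by positivity
  constructor
  · have hd : ∀ y, 0 < y → HasDerivAt (fun x => (w x ^ 2 + w' x ^ 2) * Real.exp (-|c| / x))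
        ((2 * c / y ^ 2 * (w y * w' y)) * Real.exp (-|c| / y) +
          (w y ^ 2 + w' y ^ 2) * (Real.exp (-|c| / y) * (- -|c| / y ^ 2))) y := fun y hy =>
      (hE y hy).mul (hexp _ y hy)
    have hmono : MonotoneOn (fun x => (w x ^ 2 + w' x ^ 2) * Real.exp (-|c| / x)) (Set.Ici z) := by
      refine monotoneOn_of_deriv_nonneg (convex_Ici z)
        (fun y hy => (hd y (hz.trans_le hy)).continuousAt.continuousWithinAt)
        (fun y hy => (hd y (hz.trans_le (interior_subset hy))).differentiableAt.differentiableWithinAt)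
        fun y hy => ?_
      rw [(hd y (hz.trans_le (interior_subset hy))).deriv]
      have h1 := neg_abs_le (2 * c / y ^ 2 * (w y * w' y))
      have h2 := hbound y
      have h3 : 0 ≤ (2 * c / y ^ 2 * (w y * w' y)) + |c| / y ^ 2 * (w y ^ 2 + w' y ^ 2) := by
        linarith
      calc 0 ≤ ((2 * c / y ^ 2 * (w y * w' y)) + |c| / y ^ 2 * (w y ^ 2 + w' y ^ 2)) *
            Real.exp (-|c| / y) := mul_nonneg h3 (Real.exp_pos _).le
        _ = _ := by ring
    refine (hmono Set.self_mem_Ici hx hx).trans ?_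
    exact mul_le_of_le_one_right hEnn (hexp_le _ (by simp))
  · have hd : ∀ y, 0 < y → HasDerivAt (fun x => (w x ^ 2 + w' x ^ 2) * Real.exp (|c| / x))
        ((2 * c / y ^ 2 * (w y * w' y)) * Real.exp (|c| / y) +
          (w y ^ 2 + w' y ^ 2) * (Real.exp (|c| / y) * (-|c| / y ^ 2))) y := fun y hy =>
      (hE y hy).mul (hexp _ y hy)
    have hanti : AntitoneOn (fun x => (w x ^ 2 + w' x ^ 2) * Real.exp (|c| / x)) (Set.Ici z) := by
      refine antitoneOn_of_deriv_nonpos (convex_Ici z)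
        (fun y hy => (hd y (hz.trans_le hy)).continuousAt.continuousWithinAt)
        (fun y hy => (hd y (hz.trans_le (interior_subset hy))).differentiableAt.differentiableWithinAt)
        fun y hy => ?_
      rw [(hd y (hz.trans_le (interior_subset hy))).deriv]
      have h1 := le_abs_self (2 * c / y ^ 2 * (w y * w' y))
      have h2 := hbound y
      have h3 : (2 * c / y ^ 2 * (w y * w' y)) - |c| / y ^ 2 * (w y ^ 2 + w' y ^ 2) ≤ 0 := by
        linarith
      calc _ = ((2 * c / y ^ 2 * (w y * w' y)) - |c| / y ^ 2 * (w y ^ 2 + w' y ^ 2)) *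
            Real.exp (|c| / y) := by ring
        _ ≤ 0 := mul_nonpos_of_nonpos_of_nonneg h3 (Real.exp_pos _).le
    refine le_trans ?_ (hanti Set.self_mem_Ici hx hx)
    exact le_mul_of_one_le_right hEnn (hexp_ge _ (by simp))

/-- A function whose derivative is `O(x⁻²)` has a limit at infinity. -/
theorem exists_tendsto_of_deriv_le_inv_sq {f f' : ℝ → ℝ} {z M : ℝ} (hz : 0 < z)
    (hf : ∀ x, z < x → HasDerivAt f (f' x) x) (hf' : ContinuousOn f' (Set.Ioi z))
    (hM : ∀ x, z < x → |f' x| ≤ M / x ^ 2) : ∃ l, Tendsto f atTop (𝓝 l) := by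
  refine ⟨_, tendsto_limUnder_of_hasDerivAt_of_integrableOn_Ioi (a := z) hf ?_⟩
  have h1 : IntegrableOn (fun x : ℝ => M * x ^ (-2 : ℝ)) (Set.Ioi z) :=
    (integrableOn_Ioi_rpow_of_lt (by norm_num) hz).const_mul M
  refine h1.mono' (hf'.aestronglyMeasurable measurableSet_Ioi) ?_
  filter_upwards [ae_restrict_mem measurableSet_Ioi] with x hx
  have hx0 : 0 < x := hz.trans hx
  refine (hM x hx).trans_eq ?_
  rw [Real.rpow_neg hx0.le, ← Real.rpow_natCast]
  norm_num
  rfl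

/-- Nonzero solutions of `d²w/dx² = (c / x² - 1) w` are asymptotically sinusoidal. -/
theorem exists_asymptotic_of_ode {z : ℝ} (hz : 0 < z) (hwz : w z ≠ 0)
    (hw : ∀ x, 0 < x → HasDerivAt w (w' x) x)
    (hw' : ∀ x, 0 < x → HasDerivAt w' ((c / x ^ 2 - 1) * w x) x) :
    ∃ a b : ℝ, a ^ 2 + b ^ 2 ≠ 0 ∧
      Tendsto (fun x => w x - (a * Real.cos x + b * Real.sin x)) atTop (𝓝 0) ∧
      Tendsto (fun x => w' x - (b * Real.cos x - a * Real.sin x)) atTop (𝓝 0) := by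
  set E : ℝ := (w z ^ 2 + w' z ^ 2) * Real.exp (|c| / z) with hE
  have hbd : ∀ x, z ≤ x → |w x| ≤ √E := fun x hx =>
    Real.abs_le_sqrt (by
      have := (energy_bounds_of_ode hz hw hw' hx).2
      nlinarith [sq_nonneg (w' x)])
  have hwc : ContinuousOn w (Set.Ioi z) := fun x hx =>
    (hw x (hz.trans hx)).continuousAt.continuousWithinAt
  -- Variation of constants: rotating (w, w') by the angle x leaves components with derivative
  -- (c/x²) w times -sin or cos, integrable because w is bounded. Their limits are a and b.
  have hlim : ∀ g : ℝ → ℝ, Continuous g → (∀ x, |g x| ≤ 1) → ∀ f : ℝ → ℝ,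
      (∀ x, 0 < x → HasDerivAt f (c / x ^ 2 * w x * g x) x) → ∃ l, Tendsto f atTop (𝓝 l) := by
    intro g hg hg1 f hf
    refine exists_tendsto_of_deriv_le_inv_sq (M := |c| * √E) hz (fun x hx => hf x (hz.trans hx)) ?_ ?_
    · refine ContinuousOn.mul (ContinuousOn.mul ?_ hwc) hg.continuousOn
      refine continuousOn_const.div (by fun_prop) fun x hx => ?_
      have : 0 < x := hz.trans hx
      positivity
    · intro x hx
      rw [abs_mul, abs_mul, abs_div, abs_of_nonneg (sq_nonneg x)]
      calc |c| / x ^ 2 * |w x| * |g x| ≤ |c| / x ^ 2 * √E * 1 := by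
            gcongr
            · exact hbd x (le_of_lt hx)
            · exact hg1 x
        _ = _ := by ring
  obtain ⟨a, ha⟩ := hlim (fun x => -Real.sin x) (by fun_prop)
    (fun x => by rw [abs_neg]; exact Real.abs_sin_le_one x)
    (fun x => w x * Real.cos x - w' x * Real.sin x) fun x hx => by
      refine (((hw x hx).mul (Real.hasDerivAt_cos x)).sub
        ((hw' x hx).mul (Real.hasDerivAt_sin x))).congr_deriv ?_
      ring
  obtain ⟨b, hb⟩ := hlim (fun x => Real.cos x) (by fun_prop) (fun x => Real.abs_cos_le_one x)
    (fun x => w x * Real.sin x + w' x * Real.cos x) fun x hx => by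
      refine (((hw x hx).mul (Real.hasDerivAt_sin x)).add
        ((hw' x hx).mul (Real.hasDerivAt_cos x))).congr_deriv ?_
      ring
  have hmul : ∀ (f g : ℝ → ℝ) (l : ℝ), Tendsto f atTop (𝓝 l) → (∀ x, |g x| ≤ 1) →
      Tendsto (fun x => (f x - l) * g x) atTop (𝓝 0) := fun f g l hf hg => by
    have h0 : Tendsto (fun x => f x - l) atTop (𝓝 0) := by simpa using hf.sub_const l
    exact h0.zero_mul_isBoundedUnder_le (isBoundedUnder_of ⟨1, hg⟩)
  refine ⟨a, b, ?_, ?_, ?_⟩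
  · intro h0
    -- Rotation preserves the energy, whose positive lower bound therefore passes to a² + b².
    have h1 : Tendsto (fun x => w x ^ 2 + w' x ^ 2) atTop (𝓝 (a ^ 2 + b ^ 2)) := by
      refine ((ha.pow 2).add (hb.pow 2)).congr fun x => ?_
      have := Real.sin_sq_add_cos_sq x
      linear_combination (w x ^ 2 + w' x ^ 2) * this
    have h2 := ge_of_tendsto h1 ((eventually_ge_atTop z).mono fun x hx =>
      (energy_bounds_of_ode hz hw hw' hx).1)
    have h3 : 0 < (w z ^ 2 + w' z ^ 2) * Real.exp (-|c| / z) := by positivity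
    linarith
  · have := (hmul _ _ _ ha Real.abs_cos_le_one).add (hmul _ _ _ hb Real.abs_sin_le_one)
    rw [add_zero] at this
    refine this.congr fun x => ?_
    have := Real.sin_sq_add_cos_sq x
    linear_combination w x * this
  · have := (hmul _ _ _ hb Real.abs_cos_le_one).sub (hmul _ _ _ ha Real.abs_sin_le_one)
    rw [sub_zero] at this
    refine this.congr fun x => ?_
    have := Real.sin_sq_add_cos_sq x
    linear_combination w' x * this

end Asymptotics

theorem exists_asymptotic_scaledBessel (n : ℕ) :
    ∃ a b : ℝ, a ^ 2 + b ^ 2 ≠ 0 ∧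
      Tendsto (fun x => scaledBessel n x - (a * Real.cos x + b * Real.sin x)) atTop (𝓝 0) ∧
      Tendsto (fun x => scaledBesselDeriv n x - (b * Real.cos x - a * Real.sin x)) atTop (𝓝 0) := by
  obtain ⟨z, hz, hz0⟩ := ((eventually_besselJ_ne_zero n).and self_mem_nhdsWithin).exists
  have hz0 : 0 < z := hz0
  exact exists_asymptotic_of_ode hz0 (mul_ne_zero (Real.sqrt_pos.2 hz0).ne' hz)
    (fun x hx => hasDerivAt_scaledBessel n hx) fun x hx => hasDerivAt_scaledBesselDeriv n hx

theorem exists_scaledBessel_bound (n : ℕ) :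
    ∃ C : ℝ, 0 ≤ C ∧ ∀ᶠ x in atTop, |scaledBessel n x| ≤ C := by
  obtain ⟨a, b, -, h, -⟩ := exists_asymptotic_scaledBessel n
  refine ⟨1 + (|a| + |b|), by positivity, ?_⟩
  have h1 : ∀ᶠ x in atTop, |scaledBessel n x - (a * Real.cos x + b * Real.sin x)| < 1 := by
    have := h.abs
    rw [abs_zero] at this
    exact this.eventually_lt_const one_pos
  filter_upwards [h1] with x hx
  have h2 : |a * Real.cos x + b * Real.sin x| ≤ |a| + |b| := by
    refine (abs_add_le _ _).trans ?_
    rw [abs_mul, abs_mul]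
    exact add_le_add (mul_le_of_le_one_right (abs_nonneg _) (Real.abs_cos_le_one x))
      (mul_le_of_le_one_right (abs_nonneg _) (Real.abs_sin_le_one x))
  calc |scaledBessel n x| = |(scaledBessel n x - (a * Real.cos x + b * Real.sin x)) +
        (a * Real.cos x + b * Real.sin x)| := by rw [sub_add_cancel]
    _ ≤ _ := abs_add_le _ _
    _ ≤ _ := by linarith

/-! ### Existence and divergence of the frequencies -/

/-- A continuous function that is sinusoidal at infinity, up to a positive factor, changes sign
at arbitrarily large arguments. -/
theorem exists_zero_of_asymptotic {f s : ℝ → ℝ} (hf : Continuous f) {c d : ℝ}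
    (hcd : c ^ 2 + d ^ 2 ≠ 0) (hs : ∀ x, 0 < x → 0 < s x)
    (h : Tendsto (fun x => s x * f x - (c * Real.cos x + d * Real.sin x)) atTop (𝓝 0)) :
    (∃ x, f x ≠ 0) ∧ ∀ M, ∃ z, M < z ∧ f z = 0 := by
  obtain ⟨ψ, hψ⟩ : ∃ ψ : ℝ, c * Real.cos ψ + d * Real.sin ψ ≠ 0 := by
    by_contra! hcon
    have h0 := hcon 0
    have h1 := hcon (Real.pi / 2)
    simp at h0 h1
    simp [h0, h1] at hcd
  -- Along ψ + 2πk and ψ + π + 2πk the sinusoid equals v and -v, so f eventually has opposite signs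
  -- there.
  set v := c * Real.cos ψ + d * Real.sin ψ with hv
  have htop : ∀ θ : ℝ, Tendsto (fun k : ℕ => θ + k * (2 * Real.pi)) atTop atTop := fun θ =>
    tendsto_atTop_add_const_left _ _
      (tendsto_natCast_atTop_atTop.atTop_mul_const (by positivity))
  have hx : Tendsto (fun k : ℕ => s (ψ + k * (2 * Real.pi)) * f (ψ + k * (2 * Real.pi))) atTop
      (𝓝 v) := by
    have := (h.comp (htop ψ)).add_const v
    simp only [Function.comp_def, Real.cos_add_nat_mul_two_pi, Real.sin_add_nat_mul_two_pi,
      zero_add] at this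
    exact this.congr fun k => by rw [← hv]; ring
  have hy : Tendsto (fun k : ℕ => s (ψ + Real.pi + k * (2 * Real.pi)) *
      f (ψ + Real.pi + k * (2 * Real.pi))) atTop (𝓝 (-v)) := by
    have := (h.comp (htop (ψ + Real.pi))).add_const (-v)
    simp only [Function.comp_def, Real.cos_add_nat_mul_two_pi, Real.sin_add_nat_mul_two_pi,
      zero_add, Real.cos_add_pi, Real.sin_add_pi] at this
    exact this.congr fun k => by rw [hv]; ring
  have hneg : ∀ᶠ k : ℕ in atTop,
      f (ψ + k * (2 * Real.pi)) * f (ψ + Real.pi + k * (2 * Real.pi)) < 0 := by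
    have hvv : v * -v < 0 := by
      have : 0 < v ^ 2 := by positivity
      nlinarith
    filter_upwards [(hx.mul hy).eventually_lt_const hvv, (htop ψ).eventually_gt_atTop 0,
      (htop (ψ + Real.pi)).eventually_gt_atTop 0] with k hk h1 h2
    by_contra! hcon
    have : 0 ≤ (s (ψ + k * (2 * Real.pi)) * s (ψ + Real.pi + k * (2 * Real.pi))) *
        (f (ψ + k * (2 * Real.pi)) * f (ψ + Real.pi + k * (2 * Real.pi))) :=
      mul_nonneg (mul_pos (hs _ h1) (hs _ h2)).le hcon
    nlinarith
  refine ⟨?_, fun M => ?_⟩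
  · obtain ⟨k, hk⟩ := hneg.exists
    exact ⟨_, left_ne_zero_of_mul hk.ne⟩
  · obtain ⟨k, hk, hkM⟩ := (hneg.and ((htop ψ).eventually_gt_atTop M)).exists
    have h0 : (0 : ℝ) ∈ Set.uIcc (f (ψ + k * (2 * Real.pi)))
        (f (ψ + Real.pi + k * (2 * Real.pi))) := by
      rcases mul_neg_iff.1 hk with ⟨h1, h2⟩ | ⟨h1, h2⟩
      · exact Set.mem_uIcc.2 (Or.inr ⟨h2.le, h1.le⟩)
      · exact Set.mem_uIcc.2 (Or.inl ⟨h1.le, h2.le⟩)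
    obtain ⟨z, hz, hz0⟩ := intermediate_value_uIcc hf.continuousOn h0
    refine ⟨z, hkM.trans_le ?_, hz0⟩
    rw [Set.uIcc_of_le (by linarith [Real.pi_pos])] at hz
    exact hz.1

theorem tendsto_scaledBessel_div (n : ℕ) (κ : ℝ) :
    Tendsto (fun x => κ / x * scaledBessel n x) atTop (𝓝 0) := by
  obtain ⟨C, -, hC⟩ := exists_scaledBessel_bound n
  exact (tendsto_const_nhds.div_atTop tendsto_id).zero_mul_isBoundedUnder_le ⟨C, by simpa using hC⟩

theorem sqrt_mul_deriv_besselJ (n : ℕ) {x : ℝ} (hx : 0 < x) :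
    √x * deriv (besselJ n) x = scaledBesselDeriv n x - 1 / 2 / x * scaledBessel n x := by
  rw [(hasDerivAt_besselJ n hx.ne').deriv, scaledBesselDeriv, scaledBessel, scaledBessel]
  field_simp
  ring

theorem analyticAt_charFun (bc : BoundaryCondition) (n : ℕ) (x : ℝ) :
    AnalyticAt ℝ (bc.charFun n) x := by
  have h1 := analyticAt_besselJ n x
  have h2 := analyticAt_deriv_besselJ n x
  cases bc with
  | dirichlet => exact h1
  | neumann => exact h2
  | robin h => exact (analyticAt_id.mul h2).add (analyticAt_const.mul h1)
  | robinScaled h => exact h2.add (analyticAt_const.mul h1)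

/-- √x J_n' approaches the differentiated sinusoid, so each characteristic function, suitably
rescaled, approaches a nonzero sinusoid. The zeros beyond every bound make the sets in the
definition of `alpha` nonempty, so `sInf` takes no default value. -/
theorem charFun_zeros (bc : BoundaryCondition) (n : ℕ) :
    (∃ x, bc.charFun n x ≠ 0) ∧ ∀ M, ∃ z, M < z ∧ bc.charFun n z = 0 := by
  obtain ⟨a, b, hab, hw, hw'⟩ := exists_asymptotic_scaledBessel n
  have hcont : Continuous (bc.charFun n) :=
    continuous_iff_continuousAt.2 fun x => (analyticAt_charFun bc n x).continuousAt
  have hJ' : Tendsto (fun x => √x * deriv (besselJ n) x - (b * Real.cos x + -a * Real.sin x)) atTop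
      (𝓝 0) := by
    have := hw'.sub (tendsto_scaledBessel_div n (1 / 2))
    rw [sub_zero] at this
    refine this.congr' ?_
    filter_upwards [eventually_gt_atTop 0] with x hx
    rw [sqrt_mul_deriv_besselJ n hx]
    ring
  cases bc with
  | dirichlet =>
    exact exists_zero_of_asymptotic hcont hab (s := fun x => √x) (fun x hx => Real.sqrt_pos.2 hx) hw
  | neumann =>
    exact exists_zero_of_asymptotic hcont (c := b) (d := -a) (by rwa [neg_sq, add_comm])
      (s := fun x => √x) (fun x hx => Real.sqrt_pos.2 hx) hJ'
  | robin h =>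
    refine exists_zero_of_asymptotic hcont (c := b) (d := -a) (by rwa [neg_sq, add_comm])
      -- Dividing by x removes the growth of the term z J_n'; the term with h then tends to 0.
      (s := fun x => √x / x) (fun x hx => div_pos (Real.sqrt_pos.2 hx) hx) ?_
    have := hJ'.add (tendsto_scaledBessel_div n h)
    rw [add_zero] at this
    refine this.congr' ?_
    filter_upwards [eventually_gt_atTop 0] with x hx
    simp only [BoundaryCondition.charFun, scaledBessel]
    field_simp
    ring
  | robinScaled h =>
    refine exists_zero_of_asymptotic hcont (c := b + h * a) (d := -a + h * b) ?_
      (s := fun x => √x) (fun x hx => Real.sqrt_pos.2 hx) ?_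
    · have : (b + h * a) ^ 2 + (-a + h * b) ^ 2 = (1 + (h : ℝ) ^ 2) * (a ^ 2 + b ^ 2) := by ring
      rw [this]
      exact mul_ne_zero (by positivity) hab
    · have := hJ'.add (hw.const_mul (h : ℝ))
      rw [mul_zero, add_zero] at this
      refine this.congr fun x => ?_
      simp only [BoundaryCondition.charFun, scaledBessel]
      ring

theorem alpha_le_succ (bc : BoundaryCondition) (n k : ℕ) : alpha bc n k ≤ alpha bc n (k + 1) := by
  obtain ⟨z, hz⟩ := (charFun_zeros bc n).2 (alpha bc n k)
  exact le_csInf ⟨z, hz⟩ fun y hy => hy.1.le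

/-- If the monotone sequence converged to L, isolation would leave L as the only possible zero
within ε of L. A term above L - ε would be followed by L itself, and then by a term at least L + ε.
This uses only the sets defining `alpha`, not that its values are zeros. -/
theorem tendsto_alpha (bc : BoundaryCondition) (n : ℕ) : Tendsto (alpha bc n) atTop atTop := by
  have hmono : Monotone (alpha bc n) := monotone_nat_of_le_succ (alpha_le_succ bc n)
  rcases tendsto_atTop_of_monotone hmono with h | ⟨L, hL⟩
  · exact h
  exfalso
  have hle : ∀ k, alpha bc n k ≤ L := hmono.ge_of_tendsto hL
  have hiso : ∀ᶠ z in 𝓝[≠] L, bc.charFun n z ≠ 0 := by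
    refine ((analyticAt_charFun bc n L).eventually_eq_zero_or_eventually_ne_zero).resolve_left ?_
    intro h0
    obtain ⟨x, hx⟩ := (charFun_zeros bc n).1
    exact hx (AnalyticOnNhd.eqOn_zero_of_preconnected_of_eventuallyEq_zero
      (fun y _ => analyticAt_charFun bc n y) isPreconnected_univ (Set.mem_univ L) h0
      (Set.mem_univ x))
  rw [eventually_nhdsWithin_iff, Metric.eventually_nhds_iff] at hiso
  obtain ⟨ε, hε, hiso⟩ := hiso
  have hzero : ∀ z, L - ε < z → z < L + ε → bc.charFun n z = 0 → z = L := by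
    intro z h1 h2 h3
    by_contra hne
    exact hiso (by rw [Real.dist_eq, abs_lt]; constructor <;> linarith) hne h3
  obtain ⟨k, hk⟩ := (hL.eventually_const_lt (sub_lt_self L hε)).exists
  have hkL : L ≤ alpha bc n (k + 1) := by
    obtain ⟨z, hz⟩ := (charFun_zeros bc n).2 (alpha bc n k)
    refine le_csInf ⟨z, hz⟩ fun y hy => ?_
    by_contra! hyL
    exact hyL.ne (hzero y (hk.trans hy.1) (by linarith) hy.2)
  have hkL' : alpha bc n (k + 1) = L := le_antisymm (hle _) hkL
  have : L + ε ≤ alpha bc n (k + 2) := by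
    obtain ⟨z, hz⟩ := (charFun_zeros bc n).2 (alpha bc n (k + 1))
    refine le_csInf ⟨z, hz⟩ fun y hy => ?_
    by_contra! hyL
    have hLy : L < y := hkL' ▸ hy.1
    exact hLy.ne' (hzero y (by linarith) hyL hy.2)
  linarith [hle (k + 2)]

/-! ### Growth of the radial mass -/

/-- If `dΦ/dx = o(x ^ (σ - 1))` with `σ > 0`, then `Φ = o(x ^ σ)`. -/
theorem tendsto_div_rpow_of_hasDerivAt {Φ η : ℝ → ℝ} {σ : ℝ} (hσ : 0 < σ)
    (hΦ : ∀ x, 0 < x → HasDerivAt Φ (x ^ (σ - 1) * η x) x) (hη : Tendsto η atTop (𝓝 0)) :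
    Tendsto (fun x => Φ x / x ^ σ) atTop (𝓝 0) := by
  rw [Metric.tendsto_atTop]
  intro ε hε
  have hη1 : ∀ᶠ x in atTop, |η x| < σ * (ε / 2) := by
    have := hη.abs
    rw [abs_zero] at this
    exact this.eventually_lt_const (by positivity)
  obtain ⟨S, hS⟩ := eventually_atTop.1 (hη1.and (eventually_gt_atTop 0))
  have hS0 : 0 < S := (hS S le_rfl).2
  -- A majorant of |Φ| beyond S: its derivative dominates |Φ'| there. The other half of ε absorbs |Φ
  -- S| / x^σ.
  have hB : ∀ y, 0 < y → HasDerivAt (fun x : ℝ => |Φ S| + ε / 2 * x ^ σ)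
      (ε / 2 * (σ * y ^ (σ - 1))) y := fun y hy =>
    (((Real.hasDerivAt_rpow_const (Or.inl hy.ne')).const_mul (ε / 2))).const_add _
  have hbound : ∀ x, S ≤ x → |Φ x| ≤ |Φ S| + ε / 2 * x ^ σ := by
    intro x hx
    have hpos : ∀ y, S ≤ y → 0 < y := fun y hy => hS0.trans_le hy
    refine image_norm_le_of_norm_deriv_right_le_deriv_boundary' (a := S) (b := x)
      (fun y hy => (hΦ y (hpos y hy.1)).continuousAt.continuousWithinAt)
      (fun y hy => (hΦ y (hpos y hy.1)).hasDerivWithinAt) ?_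
      (fun y hy => (hB y (hpos y hy.1)).continuousAt.continuousWithinAt)
      (fun y hy => (hB y (hpos y hy.1)).hasDerivWithinAt) ?_ ⟨hx, le_rfl⟩
    · rw [Real.norm_eq_abs]
      have : 0 ≤ ε / 2 * S ^ σ := by positivity
      linarith
    · intro y hy
      have hy0 := hpos y hy.1
      rw [Real.norm_eq_abs, abs_mul, abs_of_pos (Real.rpow_pos_of_pos hy0 _)]
      have := (hS y hy.1).1
      calc y ^ (σ - 1) * |η y| ≤ y ^ (σ - 1) * (σ * (ε / 2)) := by gcongr
        _ = _ := by ring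
  have hlim : Tendsto (fun x : ℝ => |Φ S| / x ^ σ) atTop (𝓝 0) :=
    tendsto_const_nhds.div_atTop (tendsto_rpow_atTop hσ)
  obtain ⟨N, hN⟩ := eventually_atTop.1 (hlim.eventually_lt_const (half_pos hε))
  refine ⟨max S N, fun x hx => ?_⟩
  have hx1 := le_of_max_le_left hx
  have hx0 : 0 < x := hS0.trans_le hx1
  have hxσ := Real.rpow_pos_of_pos hx0 σ
  rw [dist_zero_right, Real.norm_eq_abs, abs_div, abs_of_pos hxσ]
  have h1 := hN x (le_of_max_le_right hx)
  calc |Φ x| / x ^ σ ≤ (|Φ S| + ε / 2 * x ^ σ) / x ^ σ := by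
        gcongr
        exact hbound x hx1
    _ = |Φ S| / x ^ σ + ε / 2 := by field_simp
    _ < ε := by linarith

/-- A continuous periodic function differs from its mean by the derivative of a bounded
function. -/
theorem exists_bounded_primitive_of_periodic {g : ℝ → ℝ} {T : ℝ} (hT : 0 < T) (hg : Continuous g)
    (hper : Function.Periodic g T) :
    ∃ (G : ℝ → ℝ) (B : ℝ), (∀ x, HasDerivAt G (g x - (∫ s in 0..T, g s) / T) x) ∧ ∀ x, |G x| ≤ B := by
  set m := (∫ s in 0..T, g s) / T with hm
  set G : ℝ → ℝ := fun x => (∫ s in 0..x, g s) - x * m with hG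
  have hd : ∀ x, HasDerivAt G (g x - m) x := fun x => by
    refine ((intervalIntegral.integral_hasDerivAt_right (hg.intervalIntegrable _ _)
      (hg.stronglyMeasurableAtFilter _ _) hg.continuousAt).sub
      ((hasDerivAt_id x).mul_const m)).congr_deriv ?_
    simp
  -- Subtracting the mean makes the primitive periodic, hence bounded by its bound on one period.
  have hGper : Function.Periodic G T := fun x => by
    simp only [hG]
    rw [hper.intervalIntegral_add_eq_add 0 x (fun _ _ => hg.intervalIntegrable _ _), zero_add, hm]
    field_simp
    ring
  have hGc : Continuous G := continuous_iff_continuousAt.2 fun x => (hd x).continuousAt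
  obtain ⟨B, hB⟩ := isCompact_Icc.exists_bound_of_continuousOn (s := Set.Icc 0 T) hGc.continuousOn
  refine ⟨G, B, hd, fun x => ?_⟩
  obtain ⟨y, hy, hxy⟩ := hGper.exists_mem_Ico₀ hT x
  rw [hxy]
  exact hB y (Set.Ico_subset_Icc_self hy)

/-- The radial mass `∫₀ˣ |J_n(s)|^q s ds`. -/
noncomputable def radialMass (n : ℕ) (q x : ℝ) : ℝ := ∫ s in 0..x, |besselJ n s| ^ q * s

theorem continuous_radialMass_integrand (n : ℕ) {q : ℝ} (hq : 0 ≤ q) :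
    Continuous fun s : ℝ => |besselJ n s| ^ q * s :=
  ((continuous_besselJ n).abs.rpow_const fun _ => Or.inr hq).mul continuous_id

theorem hasDerivAt_radialMass (n : ℕ) {q : ℝ} (hq : 0 ≤ q) (x : ℝ) :
    HasDerivAt (radialMass n q) (|besselJ n x| ^ q * x) x :=
  have hc := continuous_radialMass_integrand n hq
  intervalIntegral.integral_hasDerivAt_right (hc.intervalIntegrable _ _)
    (hc.stronglyMeasurableAtFilter _ _) hc.continuousAt

theorem radialMass_sub (n : ℕ) {q : ℝ} (hq : 0 ≤ q) (x y : ℝ) :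
    radialMass n q y - radialMass n q x = ∫ s in x..y, |besselJ n s| ^ q * s :=
  have hc := continuous_radialMass_integrand n hq
  intervalIntegral.integral_interval_sub_left (hc.intervalIntegrable _ _) (hc.intervalIntegrable _ _)

theorem radialMass_mono (n : ℕ) {q : ℝ} (hq : 0 ≤ q) {x y : ℝ} (hx : 0 ≤ x) (hxy : x ≤ y) :
    radialMass n q x ≤ radialMass n q y := by
  rw [← sub_nonneg, radialMass_sub n hq]
  refine intervalIntegral.integral_nonneg hxy fun s hs => ?_
  have : 0 ≤ s := hx.trans hs.1
  positivity

theorem radialMass_pos (n : ℕ) {q : ℝ} (hq : 0 ≤ q) {x : ℝ} (hx : 0 < x) :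
    0 < radialMass n q x := by
  have hev : ∀ᶠ s in 𝓝[>] (0 : ℝ), s < x := nhdsWithin_le_nhds (Iio_mem_nhds hx)
  obtain ⟨s, ⟨hs, hsx⟩, hs0⟩ :=
    (((eventually_besselJ_ne_zero n).and hev).and self_mem_nhdsWithin).exists
  have hs0 : 0 < s := hs0
  refine intervalIntegral.integral_pos hx (continuous_radialMass_integrand n hq).continuousOn
    (fun t ht => ?_) ⟨s, ⟨hs0.le, hsx.le⟩, ?_⟩
  · have : 0 < t := ht.1
    positivity
  · positivity

/-- Separates the power from a factor bounded at infinity. The power integrates to order x^(2-q/2)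
for q ≠ 4, whence the threshold 4. -/
theorem besselJ_rpow_mul (n : ℕ) (q : ℝ) {x : ℝ} (hx : 0 < x) :
    |besselJ n x| ^ q * x = x ^ (1 - q / 2) * |scaledBessel n x| ^ q := by
  rw [scaledBessel, abs_mul, abs_of_nonneg (Real.sqrt_nonneg x),
    Real.mul_rpow (Real.sqrt_nonneg x) (abs_nonneg _), Real.sqrt_eq_rpow, ← Real.rpow_mul hx.le,
    ← mul_assoc, ← Real.rpow_add hx, show 1 - q / 2 + 1 / 2 * q = 1 by ring, Real.rpow_one, mul_comm]

/-- Powers of absolute values of asymptotically equal functions are asymptotically equal, if one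
of the functions is bounded. -/
theorem tendsto_abs_rpow_sub {f g : ℝ → ℝ} {q B : ℝ} (hq : 0 ≤ q) (hB : ∀ x, |g x| ≤ B)
    (h : Tendsto (fun x => f x - g x) atTop (𝓝 0)) :
    Tendsto (fun x => |f x| ^ q - |g x| ^ q) atTop (𝓝 0) := by
  have huc : UniformContinuousOn (fun y : ℝ => |y| ^ q) (Set.Icc (-(B + 1)) (B + 1)) :=
    isCompact_Icc.uniformContinuousOn_of_continuous
      (continuous_abs.rpow_const fun _ => Or.inr hq).continuousOn
  rw [Metric.uniformContinuousOn_iff] at huc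
  rw [Metric.tendsto_nhds] at h ⊢
  intro ε hε
  obtain ⟨δ, hδ, huc⟩ := huc ε hε
  filter_upwards [h δ hδ, h 1 one_pos] with x hx1 hx2
  rw [dist_zero_right, Real.norm_eq_abs] at hx1 hx2
  rw [dist_zero_right, ← dist_eq_norm]
  have hg := abs_le.1 (hB x)
  have hf := abs_lt.1 hx2
  exact huc _ ⟨by linarith, by linarith⟩ _ ⟨by linarith, by linarith⟩ hx1

/-- |√s J_n(s)|^q approaches a π-periodic function g with mean m > 0, so the limit constant is m/σ
with σ = 2 - q/2. -/
theorem exists_tendsto_radialMass_div (n : ℕ) {q : ℝ} (hq : 1 ≤ q) (hq4 : q < 4) :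
    ∃ C, 0 < C ∧ Tendsto (fun x => radialMass n q x / x ^ (2 - q / 2)) atTop (𝓝 C) := by
  obtain ⟨a, b, hab, hw, -⟩ := exists_asymptotic_scaledBessel n
  have hq0 : 0 ≤ q := by linarith
  set σ : ℝ := 2 - q / 2 with hσ
  have hσ0 : 0 < σ := by linarith
  set o : ℝ → ℝ := fun s => a * Real.cos s + b * Real.sin s with ho
  have hoc : Continuous o := by fun_prop
  have hobd : ∀ x, |o x| ≤ |a| + |b| := fun x => by
    refine (abs_add_le _ _).trans ?_
    rw [abs_mul, abs_mul]
    exact add_le_add (mul_le_of_le_one_right (abs_nonneg _) (Real.abs_cos_le_one x))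
      (mul_le_of_le_one_right (abs_nonneg _) (Real.abs_sin_le_one x))
  set g : ℝ → ℝ := fun s => |o s| ^ q with hg
  have hgc : Continuous g := hoc.abs.rpow_const fun _ => Or.inr hq0
  have hgper : Function.Periodic g Real.pi := fun s => by
    have : o (s + Real.pi) = -o s := by
      simp only [ho, Real.cos_add_pi, Real.sin_add_pi]
      ring
    simp only [hg, this, abs_neg]
  obtain ⟨G, B, hGd, hGB⟩ := exists_bounded_primitive_of_periodic Real.pi_pos hgc hgper
  set m := (∫ s in 0..Real.pi, g s) / Real.pi with hm
  have hm0 : 0 < m := by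
    refine div_pos (intervalIntegral.integral_pos Real.pi_pos hgc.continuousOn
      (fun s _ => by positivity) ?_) Real.pi_pos
    -- g equals |a|^q at 0 and |b|^q at π/2, and a, b are not both zero.
    by_cases ha : a = 0
    · refine ⟨Real.pi / 2, ⟨by positivity, by linarith [Real.pi_pos]⟩, ?_⟩
      have hb : b ≠ 0 := fun hb => hab (by simp [ha, hb])
      simp only [hg, ho, ha, Real.sin_pi_div_two]
      have : 0 + b * 1 ≠ 0 := by simpa using hb
      simp only [zero_mul]
      positivity
    · refine ⟨0, ⟨le_rfl, Real.pi_pos.le⟩, ?_⟩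
      simp only [hg, ho, Real.cos_zero, Real.sin_zero]
      have : a * 1 + b * 0 ≠ 0 := by simpa using ha
      positivity
  have hGdiv : ∀ κ : ℝ, Tendsto (fun x => κ / x * G x) atTop (𝓝 0) := fun κ =>
    (tendsto_const_nhds.div_atTop tendsto_id).zero_mul_isBoundedUnder_le
      (isBoundedUnder_of ⟨B, hGB⟩)
  refine ⟨m / σ, by positivity, ?_⟩
  have hη : Tendsto (fun x => (|scaledBessel n x| ^ q - g x) - (σ - 1) / x * G x) atTop (𝓝 0) := by
    simpa using (tendsto_abs_rpow_sub hq0 hobd hw).sub (hGdiv (σ - 1))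
  -- The correction x^(σ-1) G integrates g - m by parts: the derivative of Φ is x^(σ-1) times a
  -- factor tending to 0, and the correction itself is o(x^σ).
  have key := tendsto_div_rpow_of_hasDerivAt
    (Φ := fun x => radialMass n q x - x ^ (σ - 1) * G x - m / σ * x ^ σ) hσ0 (fun x hx => ?_) hη
  · have h1 := (key.add (hGdiv 1)).add_const (m / σ)
    rw [add_zero, zero_add] at h1
    refine h1.congr' ?_
    filter_upwards [eventually_gt_atTop 0] with x hx
    have hxσ := (Real.rpow_pos_of_pos hx σ).ne'
    rw [Real.rpow_sub_one hx.ne']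
    field_simp
    ring
  · refine (((hasDerivAt_radialMass n hq0 x).sub
      ((Real.hasDerivAt_rpow_const (Or.inl hx.ne')).mul (hGd x))).sub
      ((Real.hasDerivAt_rpow_const (p := σ) (Or.inl hx.ne')).const_mul (m / σ))).congr_deriv ?_
    rw [besselJ_rpow_mul n q hx, show 1 - q / 2 = σ - 1 by rw [hσ]; ring,
      Real.rpow_sub_one hx.ne' (σ - 1)]
    field_simp
    ring

theorem tendsto_radialMass_ratio_of_lt (n : ℕ) {q R : ℝ} (hq : 1 ≤ q) (hq4 : q < 4) (hR : 0 < R) :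
    Tendsto (fun x => (radialMass n q x - radialMass n q (R * x)) / radialMass n q x) atTop
      (𝓝 (1 - R ^ (2 - q / 2))) := by
  obtain ⟨C, hC, h⟩ := exists_tendsto_radialMass_div n hq hq4
  have h2 := h.comp (tendsto_id.const_mul_atTop hR)
  have h3 := ((h2.mul_const (R ^ (2 - q / 2))).div h hC.ne').const_sub 1
  rw [mul_div_assoc, mul_div_cancel₀ _ hC.ne'] at h3
  refine h3.congr' ?_
  filter_upwards [eventually_gt_atTop 0] with x hx
  have hF := (radialMass_pos n (zero_le_one.trans hq) hx).ne'
  have hx1 := (Real.rpow_pos_of_pos hx (2 - q / 2)).ne'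
  have hR1 := (Real.rpow_pos_of_pos hR (2 - q / 2)).ne'
  simp only [Function.comp_apply, Pi.div_apply, id_eq]
  rw [Real.mul_rpow hR.le hx.le]
  field_simp

theorem tendsto_radialMass_ratio_of_gt (n : ℕ) {q R : ℝ} (hq4 : 4 < q) (hR : 0 < R) (hR1 : R < 1) :
    Tendsto (fun x => (radialMass n q x - radialMass n q (R * x)) / radialMass n q x) atTop
      (𝓝 0) := by
  have hq0 : 0 ≤ q := by linarith
  obtain ⟨C, hC, hb⟩ := exists_scaledBessel_bound n
  obtain ⟨S, hS⟩ := eventually_atTop.1 hb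
  have hF1 := radialMass_pos n hq0 one_pos
  have hlim : Tendsto (fun x : ℝ => R ^ (1 - q / 2) * C ^ q / radialMass n q 1 * x ^ (-(q / 2 - 2)))
      atTop (𝓝 0) := by
    simpa using (tendsto_rpow_neg_atTop (y := q / 2 - 2) (by linarith)).const_mul
      (R ^ (1 - q / 2) * C ^ q / radialMass n q 1)
  refine squeeze_zero' ?_ ?_ hlim
  · filter_upwards [eventually_ge_atTop 0] with x hx
    have hRx : R * x ≤ x := mul_le_of_le_one_left hx hR1.le
    exact div_nonneg (sub_nonneg.2 (radialMass_mono n hq0 (by positivity) hRx))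
      ((radialMass_mono n hq0 le_rfl hx).trans' (by simp [radialMass]))
  · filter_upwards [eventually_ge_atTop 1, eventually_ge_atTop (S / R)] with x hx hxS
    have hx0 : 0 < x := by linarith
    have hRx : R * x ≤ x := mul_le_of_le_one_left hx0.le hR1.le
    have hRx0 : 0 < R * x := by positivity
    have hnum : radialMass n q x - radialMass n q (R * x) ≤ (R * x) ^ (1 - q / 2) * C ^ q * x := by
      rw [radialMass_sub n hq0]
      have h1 := intervalIntegral.norm_integral_le_of_norm_le_const (a := R * x) (b := x)
        (f := fun s => |besselJ n s| ^ q * s) (C := (R * x) ^ (1 - q / 2) * C ^ q) fun s hs => ?_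
      · refine (le_abs_self _).trans (h1.trans ?_)
        gcongr
        rw [abs_of_nonneg (by linarith)]
        linarith
      · rw [Set.uIoc_of_le hRx] at hs
        have hs0 : 0 < s := hRx0.trans hs.1
        rw [Real.norm_of_nonneg (by positivity), besselJ_rpow_mul n q hs0]
        have hsS : S ≤ s := by
          rw [div_le_iff₀ hR] at hxS
          linarith [hs.1]
        -- Since 1 - q/2 < 0, the power is largest at the left endpoint Rx.
        refine mul_le_mul (Real.rpow_le_rpow_of_nonpos hRx0 hs.1.le (by linarith))
          (Real.rpow_le_rpow (abs_nonneg _) (hS s hsS) hq0) (by positivity) (by positivity)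
    have hden : radialMass n q 1 ≤ radialMass n q x := radialMass_mono n hq0 zero_le_one hx
    calc (radialMass n q x - radialMass n q (R * x)) / radialMass n q x
        ≤ (R * x) ^ (1 - q / 2) * C ^ q * x / radialMass n q 1 :=
          div_le_div₀ (by positivity) hnum hF1 hden
      _ = _ := by
        rw [Real.mul_rpow hR.le hx0.le, show -(q / 2 - 2) = 1 - q / 2 + 1 by ring,
          Real.rpow_add_one hx0.ne']
        ring

/-! ### Polar coordinates and norms of disk modes -/

/-- Integration in polar coordinates of a product of a radial function and a function that is
homogeneous of degree zero. -/
theorem lintegral_radial_mul_homogeneous {E : Type*} [NormedAddCommGroup E] [NormedSpace ℝ E]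
    [MeasurableSpace E] [BorelSpace E] [FiniteDimensional ℝ E] [Nontrivial E] (μ : Measure E)
    [μ.IsAddHaarMeasure] {f : ℝ → ℝ≥0∞} (hf : Measurable f) {T : E → ℝ≥0∞} (hT : Measurable T)
    (hT0 : ∀ (r : ℝ) (x : E), 0 < r → T (r • x) = T x) :
    ∫⁻ x, f ‖x‖ * T x ∂μ = (∫⁻ ω : Metric.sphere (0 : E) 1, T ω ∂μ.toSphere) *
      ∫⁻ r in Set.Ioi (0 : ℝ), ENNReal.ofReal (r ^ (Module.finrank ℝ E - 1)) * f r := by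
  calc ∫⁻ x, f ‖x‖ * T x ∂μ
      = ∫⁻ x : ({(0 : E)}ᶜ : Set E), f ‖(x : E)‖ * T x ∂(μ.comap (↑)) := by
        rw [lintegral_subtype_comap (measurableSet_singleton _).compl fun x => f ‖x‖ * T x,
          restrict_compl_singleton]
    _ = ∫⁻ z : Metric.sphere (0 : E) 1 × Set.Ioi (0 : ℝ), T z.1 * f z.2
          ∂μ.toSphere.prod (.volumeIoiPow (Module.finrank ℝ E - 1)) := by
        rw [← μ.measurePreserving_homeomorphUnitSphereProd.lintegral_comp_emb
          (Homeomorph.measurableEmbedding _) fun z => T z.1 * f z.2]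
        refine lintegral_congr fun x => ?_
        rw [homeomorphUnitSphereProd_apply_fst_coe, homeomorphUnitSphereProd_apply_snd_coe,
          hT0 _ _ (inv_pos.2 (norm_pos_iff.2 x.2)), mul_comm]
    _ = (∫⁻ ω : Metric.sphere (0 : E) 1, T ω ∂μ.toSphere) *
          ∫⁻ r : Set.Ioi (0 : ℝ), f r ∂.volumeIoiPow (Module.finrank ℝ E - 1) :=
        lintegral_prod_mul (hT.comp measurable_subtype_coe).aemeasurable
          (hf.comp measurable_subtype_coe).aemeasurable
    _ = _ := by
        congr 1
        rw [Measure.volumeIoiPow, lintegral_withDensity_eq_lintegral_mul _ (by fun_prop)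
          (g := fun r : Set.Ioi (0 : ℝ) => f r) (hf.comp measurable_subtype_coe)]
        exact lintegral_subtype_comap measurableSet_Ioi
          fun r => ENNReal.ofReal (r ^ (Module.finrank ℝ E - 1)) * f r

/-- The angular factor `a cos nφ + b sin nφ`. -/
noncomputable def angularPart (n : ℕ) (a b : ℝ) (x : EuclideanSpace ℝ (Fin 2)) : ℝ :=
  a * Real.cos (n * polarAngle x) + b * Real.sin (n * polarAngle x)

/-- The mode `J_n(α r) (a cos nφ + b sin nφ)` of frequency `α`. -/
noncomputable def diskMode (n : ℕ) (α a b : ℝ) (x : EuclideanSpace ℝ (Fin 2)) : ℝ :=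
  besselJ n (α * ‖x‖) * angularPart n a b x

theorem polarAngle_smul {r : ℝ} (hr : 0 < r) (x : EuclideanSpace ℝ (Fin 2)) :
    polarAngle (r • x) = polarAngle x := by
  rw [polarAngle, polarAngle, ← Complex.arg_real_mul ⟨x 0, x 1⟩ hr]
  congr 1
  apply Complex.ext <;> simp

theorem angularPart_smul (n : ℕ) (a b : ℝ) {r : ℝ} (hr : 0 < r) (x : EuclideanSpace ℝ (Fin 2)) :
    angularPart n a b (r • x) = angularPart n a b x := by
  rw [angularPart, angularPart, polarAngle_smul hr]

theorem continuous_toComplex :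
    Continuous fun x : EuclideanSpace ℝ (Fin 2) => (⟨x 0, x 1⟩ : ℂ) := by
  have h : (fun x : EuclideanSpace ℝ (Fin 2) => (⟨x 0, x 1⟩ : ℂ)) =
      fun x => (x 0 : ℂ) + (x 1 : ℂ) * Complex.I := by
    funext x
    apply Complex.ext <;> simp
  rw [h]
  fun_prop

theorem measurable_angularPart (n : ℕ) (a b : ℝ) : Measurable (angularPart n a b) := by
  have h : Measurable polarAngle := Complex.measurable_arg.comp continuous_toComplex.measurable
  unfold angularPart
  fun_prop

theorem abs_angularPart_le (n : ℕ) (a b : ℝ) (x : EuclideanSpace ℝ (Fin 2)) :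
    |angularPart n a b x| ≤ |a| + |b| := by
  refine (abs_add_le _ _).trans ?_
  rw [abs_mul, abs_mul]
  exact add_le_add (mul_le_of_le_one_right (abs_nonneg _) (Real.abs_cos_le_one _))
    (mul_le_of_le_one_right (abs_nonneg _) (Real.abs_sin_le_one _))

/-- The argument jumps across the negative axis, but modulo 2π it is continuous off the origin, and
cos nφ and sin nφ depend only on φ modulo 2π because n is an integer. -/
theorem continuousAt_angularPart (n : ℕ) (a b : ℝ) {x : EuclideanSpace ℝ (Fin 2)} (hx : x ≠ 0) :
    ContinuousAt (angularPart n a b) x := by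
  have hz : (⟨x 0, x 1⟩ : ℂ) ≠ 0 := by
    intro h
    apply hx
    ext i
    fin_cases i
    · exact congrArg Complex.re h
    · exact congrArg Complex.im h
  have h1 : ContinuousAt (fun y => n • (polarAngle y : Real.Angle)) x :=
    (continuous_nsmul n).continuousAt.comp
      (ContinuousAt.comp (f := fun x : EuclideanSpace ℝ (Fin 2) => (⟨x 0, x 1⟩ : ℂ))
        (Complex.continuousAt_arg_coe_angle hz) continuous_toComplex.continuousAt)
  have h2 : angularPart n a b = fun y => a * (n • (polarAngle y : Real.Angle)).cos +
      b * (n • (polarAngle y : Real.Angle)).sin := by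
    funext y
    rw [angularPart, ← Real.Angle.natCast_mul_eq_nsmul, Real.Angle.cos_coe, Real.Angle.sin_coe]
  rw [h2]
  exact (continuousAt_const.mul (Real.Angle.continuous_cos.continuousAt.comp h1)).add
    (continuousAt_const.mul (Real.Angle.continuous_sin.continuousAt.comp h1))

theorem besselJ_zero_of_pos {n : ℕ} (hn : n ≠ 0) : besselJ n 0 = 0 := by
  simp [besselJ_eq, hn]

/-- At the origin, J_n(0) = 0 compensates the discontinuous angular factor when n ≥ 1; for n = 0
that factor is the constant a. Continuity turns a nonzero value into a nonzero norm. -/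
theorem continuous_diskMode (n : ℕ) (α a b : ℝ) : Continuous (diskMode n α a b) := by
  have hJ : Continuous fun x : EuclideanSpace ℝ (Fin 2) => besselJ n (α * ‖x‖) :=
    (continuous_besselJ n).comp (by fun_prop)
  rcases eq_or_ne n 0 with rfl | hn
  · have : diskMode 0 α a b = fun x => besselJ 0 (α * ‖x‖) * a := by
      funext x
      simp [diskMode, angularPart]
    rw [this]
    exact hJ.mul continuous_const
  · rw [continuous_iff_continuousAt]
    intro x
    by_cases hx : x = 0
    · subst hx
      have h0 : diskMode n α a b 0 = 0 := by simp [diskMode, besselJ_zero_of_pos hn]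
      rw [ContinuousAt, h0]
      have hJ0 := hJ.tendsto 0
      rw [norm_zero, mul_zero, besselJ_zero_of_pos hn] at hJ0
      exact hJ0.zero_mul_isBoundedUnder_le (isBoundedUnder_of ⟨_, abs_angularPart_le n a b⟩)
    · exact hJ.continuousAt.mul (continuousAt_angularPart n a b hx)

theorem isOpen_unitDisk : IsOpen unitDisk := isOpen_lt continuous_norm continuous_const

theorem isOpen_annulus (R : ℝ) : IsOpen (annulus R) :=
  (isOpen_lt continuous_const continuous_norm).inter (isOpen_lt continuous_norm continuous_const)

theorem unitDisk_eq_ball : unitDisk = Metric.ball 0 1 := by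
  ext x
  simp [unitDisk]

theorem isFiniteMeasure_restrict_unitDisk :
    IsFiniteMeasure ((volume : Measure (EuclideanSpace ℝ (Fin 2))).restrict unitDisk) :=
  ⟨by rw [Measure.restrict_apply_univ, unitDisk_eq_ball]; exact measure_ball_lt_top⟩

theorem memLp_diskMode (n : ℕ) (α a b : ℝ) (p : ℝ≥0∞) :
    MemLp (diskMode n α a b) p (volume.restrict unitDisk) := by
  have := isFiniteMeasure_restrict_unitDisk
  obtain ⟨C, hC⟩ := (isCompact_closedBall (0 : EuclideanSpace ℝ (Fin 2)) 1).exists_bound_of_continuousOn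
    (continuous_diskMode n α a b).continuousOn
  refine MemLp.of_bound (continuous_diskMode n α a b).aestronglyMeasurable C ?_
  filter_upwards [ae_restrict_mem isOpen_unitDisk.measurableSet] with x hx
  exact hC x (Metric.ball_subset_closedBall (unitDisk_eq_ball ▸ hx))

theorem eLpNorm_diskMode_ne_zero {n : ℕ} {α a b : ℝ} {p : ℝ≥0∞} (hp : p ≠ 0)
    (h : ∃ x ∈ unitDisk, diskMode n α a b x ≠ 0) :
    eLpNorm (diskMode n α a b) p (volume.restrict unitDisk) ≠ 0 := by
  rw [Ne, eLpNorm_eq_zero_iff (continuous_diskMode n α a b).aestronglyMeasurable hp]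
  intro h0
  obtain ⟨x, hx, hx0⟩ := h
  exact hx0 (Measure.eqOn_open_of_ae_eq h0 isOpen_unitDisk
    (continuous_diskMode n α a b).continuousOn continuousOn_const hx)

/-- The `q`-th power of the `L^q` norm of a mode over an annulus factorizes. -/
theorem lintegral_diskMode_annulus (n : ℕ) {α : ℝ} (a b : ℝ) {q R : ℝ} (hα : 0 < α) (hq : 0 ≤ q)
    (hR : 0 ≤ R) (hR1 : R < 1) :
    ∫⁻ x in annulus R, ‖diskMode n α a b x‖ₑ ^ q =
      (∫⁻ ω : Metric.sphere (0 : EuclideanSpace ℝ (Fin 2)) 1, ‖angularPart n a b ω‖ₑ ^ q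
        ∂(volume : Measure (EuclideanSpace ℝ (Fin 2))).toSphere) *
      ENNReal.ofReal ((α ^ 2)⁻¹ * (radialMass n q α - radialMass n q (R * α))) := by
  set f : ℝ → ℝ≥0∞ := (Set.Ioo R 1).indicator fun r => ‖besselJ n (α * r)‖ₑ ^ q with hf
  have hJc : Continuous fun r : ℝ => besselJ n (α * r) := (continuous_besselJ n).comp (by fun_prop)
  have hfm : Measurable f :=
    (hJc.measurable.enorm.pow_const q).indicator measurableSet_Ioo
  have h1 : ∫⁻ x in annulus R, ‖diskMode n α a b x‖ₑ ^ q =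
      ∫⁻ x, f ‖x‖ * ‖angularPart n a b x‖ₑ ^ q := by
    rw [← lintegral_indicator (isOpen_annulus R).measurableSet]
    refine lintegral_congr fun x => ?_
    by_cases hx : x ∈ annulus R
    · rw [Set.indicator_of_mem hx, hf, Set.indicator_of_mem (show ‖x‖ ∈ Set.Ioo R 1 from hx),
        diskMode, enorm_mul, ENNReal.mul_rpow_of_nonneg _ _ hq]
    · rw [Set.indicator_of_notMem hx, hf,
        Set.indicator_of_notMem (show ‖x‖ ∉ Set.Ioo R 1 from hx), zero_mul]
  rw [h1, lintegral_radial_mul_homogeneous volume hfm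
    ((measurable_angularPart n a b).enorm.pow_const q)
    fun r x hr => by rw [angularPart_smul n a b hr]]
  congr 1
  have hc : Continuous fun r : ℝ => |besselJ n (α * r)| ^ q * r :=
    (hJc.abs.rpow_const fun _ => Or.inr hq).mul continuous_id
  have h2 : ∀ r ∈ Set.Ioi (0 : ℝ), ENNReal.ofReal (r ^ (Module.finrank ℝ
      (EuclideanSpace ℝ (Fin 2)) - 1)) * f r =
      (Set.Ioo R 1).indicator (fun r => ENNReal.ofReal (|besselJ n (α * r)| ^ q * r)) r := by
    intro r hr
    have hr : 0 < r := hr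
    by_cases hrR : r ∈ Set.Ioo R 1
    · rw [hf, Set.indicator_of_mem hrR, Set.indicator_of_mem hrR, finrank_euclideanSpace_fin,
        Real.enorm_eq_ofReal_abs, ENNReal.ofReal_rpow_of_nonneg (abs_nonneg _) hq,
        ← ENNReal.ofReal_mul (by positivity)]
      norm_num [mul_comm]
    · rw [hf, Set.indicator_of_notMem hrR, Set.indicator_of_notMem hrR, mul_zero]
  rw [setLIntegral_congr_fun measurableSet_Ioi h2, lintegral_indicator measurableSet_Ioo,
    Measure.restrict_restrict measurableSet_Ioo,
    Set.inter_eq_left.2 fun r hr => Set.mem_Ioi.2 (hR.trans_lt hr.1),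
    restrict_Ioo_eq_restrict_Ioc,
    ← ofReal_integral_eq_lintegral_ofReal
      ((hc.intervalIntegrable R 1).1) ?_, ← intervalIntegral.integral_of_le hR1.le]
  · congr 1
    -- Prepares the substitution s = αr; the weight r and dr each contribute a factor α⁻¹.
    have h3 : ∀ r : ℝ, |besselJ n (α * r)| ^ q * r = α⁻¹ * (|besselJ n (α * r)| ^ q * (α * r)) :=
      fun r => by field_simp
    rw [intervalIntegral.integral_congr fun r _ => h3 r, intervalIntegral.integral_const_mul,
      intervalIntegral.integral_comp_mul_left (fun s => |besselJ n s| ^ q * s) hα.ne',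
      radialMass_sub n hq, mul_one, mul_comm α R, smul_eq_mul, ← mul_assoc, sq, mul_inv]
  · filter_upwards [ae_restrict_mem measurableSet_Ioc] with r hr
    have : 0 < r := hR.trans_lt hr.1
    positivity

/-- Treating the disk as the annulus with R = 0 lets one factorization serve numerator and
denominator. -/
theorem restrict_annulus_zero :
    (volume : Measure (EuclideanSpace ℝ (Fin 2))).restrict (annulus 0) =
      volume.restrict unitDisk := by
  have h : annulus 0 = unitDisk \ {0} := by
    ext x
    simp [annulus, unitDisk, and_comm]
  rw [h]
  exact Measure.restrict_congr_set (sdiff_null_ae_eq_self (measure_singleton 0))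

/-- The ratio of norms of a mode expressed by the radial mass. -/
theorem lpRatio_diskMode (n : ℕ) {α a b : ℝ} {p : ℝ≥0∞} {R : ℝ} (hα : 0 < α) (hp : p ≠ 0)
    (hp' : p ≠ ⊤) (hR : 0 ≤ R) (hR1 : R < 1) (h : ∃ x ∈ unitDisk, diskMode n α a b x ≠ 0) :
    lpRatio p R (diskMode n α a b) =
      ((radialMass n p.toReal α - radialMass n p.toReal (R * α)) / radialMass n p.toReal α) ^
        (1 / p.toReal) := by
  have hq : 0 < p.toReal := ENNReal.toReal_pos hp hp'
  have hmem := (memLp_diskMode n α a b p).2.ne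
  have hne := eLpNorm_diskMode_ne_zero hp h
  have hF := radialMass_pos n hq.le hα
  rw [lpRatio]
  simp only [← restrict_annulus_zero, eLpNorm_eq_lintegral_rpow_enorm_toReal hp hp',
    lintegral_diskMode_annulus n a b hα hq.le le_rfl one_pos,
    lintegral_diskMode_annulus n a b hα hq.le hR hR1] at hmem hne ⊢
  set K := ∫⁻ ω : Metric.sphere (0 : EuclideanSpace ℝ (Fin 2)) 1,
    ‖angularPart n a b ω‖ₑ ^ p.toReal ∂(volume : Measure (EuclideanSpace ℝ (Fin 2))).toSphere
  have h0 : radialMass n p.toReal (0 * α) = 0 := by simp [radialMass]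
  rw [h0, sub_zero] at hmem hne ⊢
  -- The angular integral K needs no evaluation: it is nonzero and finite because the norm on the
  -- disk is, and then it cancels.
  have hK0 : K ≠ 0 := by
    intro hK
    rw [hK, zero_mul, ENNReal.zero_rpow_of_pos (by positivity)] at hne
    exact hne rfl
  have hKtop : K ≠ ⊤ := by
    intro hK
    rw [hK, ENNReal.top_mul (ENNReal.ofReal_pos.2 (by positivity)).ne',
      ENNReal.top_rpow_of_pos (by positivity)] at hmem
    exact hmem rfl
  have hKr : 0 < K.toReal := ENNReal.toReal_pos hK0 hKtop
  have hA : 0 ≤ radialMass n p.toReal α - radialMass n p.toReal (R * α) :=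
    sub_nonneg.2 (radialMass_mono n hq.le (by positivity) (mul_le_of_le_one_left hα.le hR1.le))
  rw [← ENNReal.toReal_rpow, ← ENNReal.toReal_rpow, ENNReal.toReal_mul, ENNReal.toReal_mul,
    ENNReal.toReal_ofReal (by positivity), ENNReal.toReal_ofReal (by positivity),
    ← Real.div_rpow (by positivity) (by positivity)]
  congr 1
  field_simp

/-- By continuity, the set where the essential supremum is exceeded is open; being null, it is
empty. -/
theorem enorm_diskMode_le {n : ℕ} {α a b : ℝ} {y : EuclideanSpace ℝ (Fin 2)} (hy : y ∈ unitDisk) :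
    ‖diskMode n α a b y‖ₑ ≤ eLpNorm (diskMode n α a b) ⊤ (volume.restrict unitDisk) := by
  set S := eLpNorm (diskMode n α a b) ⊤ (volume.restrict unitDisk) with hS
  have hopen : IsOpen (unitDisk ∩ {x | S < ‖diskMode n α a b x‖ₑ}) :=
    isOpen_unitDisk.inter (isOpen_lt continuous_const (continuous_diskMode n α a b).enorm)
  have hnull : volume (unitDisk ∩ {x | S < ‖diskMode n α a b x‖ₑ}) = 0 := by
    have h := ae_le_eLpNormEssSup (f := diskMode n α a b) (μ := volume.restrict unitDisk)
    rw [← eLpNorm_exponent_top, ← hS, ae_restrict_iff' isOpen_unitDisk.measurableSet, ae_iff] at h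
    refine measure_mono_null (fun x hx => ?_) h
    simpa using hx
  have hempty := (hopen.measure_eq_zero_iff volume).1 hnull
  by_contra! hcon
  exact (Set.eq_empty_iff_forall_notMem.1 hempty y) ⟨hy, hcon⟩

theorem lpRatio_top_diskMode_le {n : ℕ} {α a b R s C : ℝ} (hα : 0 < α) (hs : 0 < s) (hsα : s < α)
    (hR : 0 < R) (hJ : besselJ n s ≠ 0) (hC : 0 ≤ C)
    (hb : ∀ r, R < r → r < 1 → |besselJ n (α * r)| ≤ C)
    (h : ∃ x ∈ unitDisk, diskMode n α a b x ≠ 0) :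
    lpRatio ⊤ R (diskMode n α a b) ≤ C / |besselJ n s| := by
  set S := eLpNorm (diskMode n α a b) ⊤ (volume.restrict unitDisk) with hS
  have hS0 : S ≠ 0 := eLpNorm_diskMode_ne_zero (by simp) h
  have hStop : S ≠ ⊤ := (memLp_diskMode n α a b ⊤).2.ne
  have hSr : 0 < S.toReal := ENNReal.toReal_pos hS0 hStop
  have hpt : ∀ x ∈ annulus R, ‖diskMode n α a b x‖ ≤ C / |besselJ n s| * S.toReal := by
    intro x hx
    have hx0 : 0 < ‖x‖ := hR.trans hx.1
    have hc : 0 < s / (α * ‖x‖) := by positivity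
    -- The point on the same ray at radius s/α: same angular factor, and radial factor J_n(s)
    -- whatever α is.
    set y := (s / (α * ‖x‖)) • x with hy
    have hyn : ‖y‖ = s / α := by
      rw [hy, norm_smul, Real.norm_of_nonneg hc.le]
      field_simp
    have hyD : y ∈ unitDisk := by
      change ‖y‖ < 1
      rw [hyn, div_lt_one hα]
      exact hsα
    have hval : diskMode n α a b y = besselJ n s * angularPart n a b x := by
      rw [diskMode, hyn, hy, angularPart_smul n a b hc, mul_div_cancel₀ _ hα.ne']
    have hle : |besselJ n s| * |angularPart n a b x| ≤ S.toReal := by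
      rw [← abs_mul, ← hval, ← Real.norm_eq_abs, ← toReal_enorm]
      exact ENNReal.toReal_mono hStop (enorm_diskMode_le hyD)
    have hJpos : 0 < |besselJ n s| := abs_pos.2 hJ
    rw [diskMode, norm_mul, Real.norm_eq_abs, Real.norm_eq_abs]
    calc |besselJ n (α * ‖x‖)| * |angularPart n a b x| ≤ C * |angularPart n a b x| :=
          mul_le_mul_of_nonneg_right (hb _ hx.1 hx.2) (abs_nonneg _)
      _ = C / |besselJ n s| * (|besselJ n s| * |angularPart n a b x|) := by field_simp
      _ ≤ _ := by gcongr
  have hann : eLpNorm (diskMode n α a b) ⊤ (volume.restrict (annulus R)) ≤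
      ENNReal.ofReal (C / |besselJ n s| * S.toReal) := by
    rw [eLpNorm_exponent_top]
    refine eLpNormEssSup_le_of_ae_bound ?_
    filter_upwards [ae_restrict_mem (isOpen_annulus R).measurableSet] with x hx
    exact hpt x hx
  rw [lpRatio, div_le_iff₀ hSr]
  exact ENNReal.toReal_le_of_le_ofReal (by positivity) hann

/-! ### The limit along the sequence of eigenfunctions -/

theorem IsDiskMode.exists_eqOn_diskMode {bc : BoundaryCondition} {n k : ℕ}
    {u : EuclideanSpace ℝ (Fin 2) → ℝ} (hu : IsDiskMode bc n k u) :
    ∃ a b : ℝ, Set.EqOn u (diskMode n (alpha bc n k) a b) unitDisk ∧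
      ∃ x ∈ unitDisk, diskMode n (alpha bc n k) a b x ≠ 0 := by
  obtain ⟨⟨a, b, hab⟩, x, hx, hx0⟩ := hu
  have h : Set.EqOn u (diskMode n (alpha bc n k) a b) unitDisk := fun y hy => by
    rw [hab y hy, modeCos, modeSin, diskMode, angularPart]
    ring
  exact ⟨a, b, h, x, hx, h hx ▸ hx0⟩

theorem ae_eq_restrict_of_eqOn {u v : EuclideanSpace ℝ (Fin 2) → ℝ} (h : Set.EqOn u v unitDisk) :
    u =ᵐ[volume.restrict unitDisk] v := by
  filter_upwards [ae_restrict_mem isOpen_unitDisk.measurableSet] with x hx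
  exact h hx

theorem lpRatio_congr {u v : EuclideanSpace ℝ (Fin 2) → ℝ} (h : Set.EqOn u v unitDisk)
    (p : ℝ≥0∞) (R : ℝ) : lpRatio p R u = lpRatio p R v := by
  have h1 : u =ᵐ[volume.restrict (annulus R)] v := by
    filter_upwards [ae_restrict_mem (isOpen_annulus R).measurableSet] with x hx
    exact h hx.2
  rw [lpRatio, lpRatio, eLpNorm_congr_ae h1, eLpNorm_congr_ae (ae_eq_restrict_of_eqOn h)]

/-- The limit relation for finite exponents, once the radial masses are understood. -/
theorem tendsto_lpRatio_of_tendsto_radialMass {bc : BoundaryCondition} {n : ℕ} {R l : ℝ}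
    (hR0 : 0 < R) (hR1 : R < 1) {p : ℝ≥0∞} (hp : p ≠ 0) (hp' : p ≠ ⊤)
    {u : ℕ → EuclideanSpace ℝ (Fin 2) → ℝ} (hu : ∀ k, 1 ≤ k → IsDiskMode bc n k (u k))
    (hl : Tendsto (fun x => (radialMass n p.toReal x - radialMass n p.toReal (R * x)) /
      radialMass n p.toReal x) atTop (𝓝 l)) :
    Tendsto (fun k => lpRatio p R (u k)) atTop (𝓝 (l ^ (1 / p.toReal))) := by
  have hq : 0 < p.toReal := ENNReal.toReal_pos hp hp'
  refine ((hl.comp (tendsto_alpha bc n)).rpow_const (p := 1 / p.toReal)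
    (Or.inr (by positivity))).congr' ?_
  -- The index k = 0 is excluded: `u 0` is arbitrary and `alpha bc n 0` is 0 by convention.
  filter_upwards [eventually_ge_atTop 1, (tendsto_alpha bc n).eventually_gt_atTop 0] with k hk hα
  obtain ⟨a, b, heq, hx⟩ := (hu k hk).exists_eqOn_diskMode
  rw [lpRatio_congr heq, lpRatio_diskMode n hα hp hp' hR0.le hR1 hx]
  rfl

theorem tendsto_lpRatio_top {bc : BoundaryCondition} {n : ℕ} {R : ℝ} (hR0 : 0 < R)
    {u : ℕ → EuclideanSpace ℝ (Fin 2) → ℝ} (hu : ∀ k, 1 ≤ k → IsDiskMode bc n k (u k)) :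
    Tendsto (fun k => lpRatio ⊤ R (u k)) atTop (𝓝 0) := by
  obtain ⟨C, hC0, hC⟩ := exists_scaledBessel_bound n
  obtain ⟨S, hS⟩ := eventually_atTop.1 hC
  obtain ⟨s, hJ, hs⟩ := ((eventually_besselJ_ne_zero n).and self_mem_nhdsWithin).exists
  have hs : 0 < s := hs
  have hα := tendsto_alpha bc n
  have hlim : Tendsto (fun k => C / √(R * alpha bc n k) / |besselJ n s|) atTop (𝓝 0) := by
    have h := (tendsto_const_nhds (x := C)).div_atTop
      (Real.tendsto_sqrt_atTop.comp (hα.const_mul_atTop hR0))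
    simpa using h.div_const |besselJ n s|
  refine squeeze_zero' (Eventually.of_forall fun k =>
    div_nonneg ENNReal.toReal_nonneg ENNReal.toReal_nonneg) ?_ hlim
  filter_upwards [eventually_ge_atTop 1, hα.eventually_gt_atTop s,
    hα.eventually_ge_atTop (S / R)] with k hk hks hkS
  obtain ⟨a, b, heq, hx⟩ := (hu k hk).exists_eqOn_diskMode
  have hα0 : 0 < alpha bc n k := hs.trans hks
  rw [lpRatio_congr heq]
  refine lpRatio_top_diskMode_le hα0 hs hks hR0 hJ (by positivity) (fun r hr _ => ?_) hx
  have hRα : 0 < R * alpha bc n k := by positivity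
  -- On the annulus the argument αr is at least Rα, so |J_n(αr)| ≤ C/√(αr) ≤ C/√(Rα).
  have hle : R * alpha bc n k ≤ alpha bc n k * r := by
    rw [mul_comm R]
    gcongr
  have hbd := hS (alpha bc n k * r) (by
    rw [div_le_iff₀ hR0] at hkS
    linarith)
  rw [scaledBessel, abs_mul, abs_of_nonneg (Real.sqrt_nonneg _)] at hbd
  rw [le_div_iff₀ (Real.sqrt_pos.2 hRα), mul_comm]
  refine le_trans ?_ hbd
  gcongr

theorem theorem2p4 (bc : BoundaryCondition) (n : ℕ) (R : ℝ) (hR0 : 0 < R) (hR1 : R < 1)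
    (p : ℝ≥0∞) (hp : 1 ≤ p) (u : ℕ → EuclideanSpace ℝ (Fin 2) → ℝ)
    (hu : ∀ k, 1 ≤ k → IsDiskMode bc n k (u k)) :
    (∀ k, 1 ≤ k → MemLp (u k) p (volume.restrict unitDisk) ∧
      eLpNorm (u k) p (volume.restrict unitDisk) ≠ 0) ∧
    (p < 4 → Tendsto (fun k => lpRatio p R (u k)) atTop
      (𝓝 ((1 - R ^ (2 - p.toReal / 2)) ^ (1 / p.toReal)))) ∧
    (4 < p → Tendsto (fun k => lpRatio p R (u k)) atTop (𝓝 0)) := by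
  have hp0 : p ≠ 0 := (zero_lt_one.trans_le hp).ne'
  refine ⟨fun k hk => ?_, fun h4 => ?_, fun h4 => ?_⟩
  · obtain ⟨a, b, heq, hx⟩ := (hu k hk).exists_eqOn_diskMode
    have hae := ae_eq_restrict_of_eqOn heq
    rw [eLpNorm_congr_ae hae]
    exact ⟨(memLp_diskMode n _ a b p).ae_eq hae.symm, eLpNorm_diskMode_ne_zero hp0 hx⟩
  · have hptop : p ≠ ⊤ := h4.ne_top
    have hq1 : 1 ≤ p.toReal := by simpa using ENNReal.toReal_mono hptop hp
    have hq4 : p.toReal < 4 := by simpa using ENNReal.toReal_strict_mono (by simp) h4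
    exact tendsto_lpRatio_of_tendsto_radialMass hR0 hR1 hp0 hptop hu
      (tendsto_radialMass_ratio_of_lt n hq1 hq4 hR0)
  · rcases eq_or_ne p ⊤ with rfl | hptop
    · exact tendsto_lpRatio_top hR0 hu
    · have hq4 : 4 < p.toReal := by simpa using ENNReal.toReal_strict_mono hptop h4
      have h := tendsto_lpRatio_of_tendsto_radialMass hR0 hR1 hp0 hptop hu
        (tendsto_radialMass_ratio_of_gt n hq4 hR0 hR1)
      rwa [Real.zero_rpow (by positivity)] at h
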